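/- Let $R$ be a commutative ring (with $1$, not necessarily Noetherian), let $\underline{x}=x_1,\ldots,x_k$ be elements of $R$, let $J=(x_1,\ldots,x_k)R$, and let $M$ be an $R$-module. For $x\in R$ let $M_x$ be the localization of $M$ at the powers of $x$. Put $$\mathcal D_J(M)=\varinjlim_n \operatorname{Hom}_R(J^n,M),$$ with transition maps the restrictions. For $x,y\in J$ write $y\ge x$ if $x\in\operatorname{Rad}(yR)$, say $x^{c}=yr$ with $r\in R$; then there is a canonical map $M_y\to M_x$, $m/y^n\mapsto r^nm/x^{cn}$, and $\varprojlim_{x\in J}M_x$ is the inverse limit of this system. Consider the Čech complex $$0\to M\xrightarrow{d^0}\bigoplus_{i}M_{x_i}\xrightarrow{d^1}\bigoplus_{i<j}M_{x_ix_j}\to\cdots\to M_{x_1\cdots x_k}\to 0,$$ and set $\check D^0_{\underline x}(M)=\ker d^1$ and $\check H^1_{\underline x}(M)=\ker d^1/\operatorname{im} d^0$. For $n\ge 1$ let $\underline x^{(n)}=x_1^n,\ldots,x_k^n$ and let $H_1(\underline x^{(n)};R)$ be the first Koszul homology; for $m\ge n$ the natural map $H_1(\underline x^{(m)};R)\to H_1(\underline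 x^{(n)};R)$ is the one induced by the map of Koszul complexes that is the identity in degree $0$ and sends $e_i$ to $x_i^{m-n}e_i$ in degree $1$ and $e_i\wedge e_j$ to $x_i^{m-n}x_j^{m-n}\,e_i\wedge e_j$ in degree $2$. For $\phi\in\mathcal D_J(M)$ represented by $\phi_n\in\operatorname{Hom}_R(J^n,M)$, and for $f=(f_x)_{x\in J}\in\varprojlim_{x\in J}M_x$, put $$\theta_M(\phi)=\bigl(\phi_n(x^n)/x^n\bigr)_{x\in J},\qquad \rho_M(\phi)=\bigl(\phi_n(x_i^n)/x_i^n\bigr)_{i=1}^k,\qquad \sigma_M(f)=(f_{x_i})_{i=1}^k .$$ These are well-defined $R$-linear maps $\theta_M:\mathcal D_J(M)\to\varprojlim_{x\in J}M_x$, $\rho_M:\mathcal D_J(M)\to\check D^0_{\underline x}(M)$ and $\sigma_M:\varprojlim_{x\in J}M_x\to\check D^0_{\underline x}(M)$, with $\rho_M=\sigma_M\circ\theta_M$, and the following hold. 1. $\theta_M$ and $\rho_M$ are injective and $\sigma_M$ is an isomorphism. 2. $\theta_M$ is an isomorphism if and only if $\check H^1_{\underline x}(\mathcal D_J(M))=0$;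 likewise, $\rho_M$ is an isomorphism if and only if $\check H^1_{\underline x}(\mathcal D_J(M))=0$. 3. $\theta_M$ is an isomorphism for every $R$-module $M$ if and only if the inverse system $\{H_1(\underline x^{(n)};R)\}_{n\ge1}$ is pro-zero, i.e. for every $n\ge 1$ there is an $m\ge n$ such that $H_1(\underline x^{(m)};R)\to H_1(\underline x^{(n)};R)$ is zero; likewise, $\rho_M$ is an isomorphism for every $R$-module $M$ if and only if this system is pro-zero. -/

import Mathlib

universe u v w

noncomputable section

namespace Deligne

/-! ### The ideal transform `D_J(M) = lim→ Hom_R(J^n, M)` -/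

section IdealTransform

variable {R : Type u} [CommRing R] (J : Ideal R) (M : Type w) [AddCommGroup M] [Module R M]

/-- The restriction `Hom_R(J^n, M) → Hom_R(J^m, M)` for `n ≤ m`. -/
def homRestrict (n m : ℕ) (h : n ≤ m) :
    (↥(J ^ n) →ₗ[R] M) →ₗ[R] (↥(J ^ m) →ₗ[R] M) :=
  LinearMap.lcomp R M (Submodule.inclusion (Ideal.pow_le_pow_right h))

/-- The ideal transform `D_J(M) = lim→ Hom_R(J^n, M)`. -/
abbrev IdealTransform : Type (max u w) :=
  Module.DirectLimit (fun n : ℕ => ↥(J ^ n) →ₗ[R] M) (homRestrict J M)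

end IdealTransform

/-! ### Localizations `M_x` and their transition maps -/

section Localization

variable {R : Type u} [CommRing R] (M : Type w) [AddCommGroup M] [Module R M]

/-- The localization `M_x` of `M` at the powers of `x`. -/
abbrev Loc (x : R) : Type (max u w) := LocalizedModule (Submonoid.powers x) M

variable {M} in
/-- The fraction `m / x^n` in `M_x`. -/
abbrev frac (x : R) (m : M) (n : ℕ) : Loc M x :=
  LocalizedModule.mk m (⟨x ^ n, n, rfl⟩ : Submonoid.powers x)

theorem isUnit_of_mem_radical {x y : R} (h : x ∈ (Ideal.span {y}).radical)
    (s : Submonoid.powers y) :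
    IsUnit (algebraMap R (Module.End R (Loc M x)) s) := by
  obtain ⟨k, hk⟩ := h
  obtain ⟨r, hr⟩ := Ideal.mem_span_singleton'.1 hk
  have hx : IsUnit (algebraMap R (Module.End R (Loc M x)) x) :=
    IsLocalizedModule.map_units (S := Submonoid.powers x)
      (LocalizedModule.mkLinearMap (Submonoid.powers x) M) ⟨x, 1, pow_one x⟩
  have hy : IsUnit (algebraMap R (Module.End R (Loc M x)) y) := by
    have h1 := hx.pow k
    rw [← map_pow, ← hr, map_mul] at h1
    exact ((Commute.isUnit_mul_iff
      (Algebra.commutes r (algebraMap R (Module.End R (Loc M x)) y))).1 h1).2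
  obtain ⟨_, n, rfl⟩ := s
  simpa only [map_pow] using hy.pow n

/-- For `x ∈ Rad(yR)` the canonical homomorphism `M_y → M_x`, that is, the unique `R`-linear
map sending `m / 1` to `m / 1`; see `res_frac` for the explicit formula. -/
def res {x y : R} (h : x ∈ (Ideal.span {y}).radical) : Loc M y →ₗ[R] Loc M x :=
  LocalizedModule.lift (Submonoid.powers y)
    (LocalizedModule.mkLinearMap (Submonoid.powers x) M) (isUnit_of_mem_radical M h)

/-- If `x ^ k = y r`, then `M_y → M_x` is `m / y^n ↦ r^n m / x^(k n)`. -/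
theorem res_frac {x y r : R} {k : ℕ} (h : x ∈ (Ideal.span {y}).radical) (hk : x ^ k = y * r)
    (m : M) (n : ℕ) : res M h (frac y m n) = frac x (r ^ n • m) (k * n) := by
  rw [res, LocalizedModule.lift_mk, Module.End.algebraMap_isUnit_inv_apply_eq_iff,
    LocalizedModule.mkLinearMap_apply, LocalizedModule.smul'_mk, LocalizedModule.mk_eq]
  refine ⟨1, ?_⟩
  simp only [one_smul, Submonoid.smul_def, smul_smul]
  rw [pow_mul, hk, mul_pow]

theorem mul_mem_radical_left (x y : R) : x * y ∈ (Ideal.span {x}).radical :=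
  Ideal.le_radical (Ideal.mem_span_singleton.2 (Dvd.intro y rfl))

theorem mul_mem_radical_right (x y : R) : x * y ∈ (Ideal.span {y}).radical :=
  Ideal.le_radical (Ideal.mem_span_singleton.2 (Dvd.intro_left x rfl))

/-- The inverse limit `lim← M_x` over the elements `x` of `J`, where `y ≥ x` means
`x ∈ Rad(yR)`: the families in `∏_{x ∈ J} M_x` compatible with the maps `M_y → M_x`. -/
def limLoc (J : Ideal R) : Submodule R (∀ x : J, Loc M (x : R)) where
  carrier := {f | ∀ (x y : J) (h : (x : R) ∈ (Ideal.span {(y : R)}).radical),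
    res M h (f y) = f x}
  add_mem' := by
    intro f g hf hg x y h
    simp only [Pi.add_apply, map_add, hf x y h, hg x y h]
  zero_mem' := by
    intro x y h
    simp only [Pi.zero_apply, map_zero]
  smul_mem' := by
    intro r f hf x y h
    simp only [Pi.smul_apply, map_smul, hf x y h]

end Localization

/-! ### The Čech complex in degrees `0, 1, 2` -/

section Cech

variable {R : Type u} [CommRing R] {k : ℕ} (x : Fin k → R)
  (M : Type w) [AddCommGroup M] [Module R M]

/-- The pairs `i < j` of indices. -/
abbrev Pairs (k : ℕ) : Type := {p : Fin k × Fin k // p.1 < p.2}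

/-- `d⁰ : M → ⊕_i M_{x_i}`, `m ↦ (m / 1)_i`. -/
def cechD0 : M →ₗ[R] ∀ i : Fin k, Loc M (x i) :=
  LinearMap.pi fun i => LocalizedModule.mkLinearMap (Submonoid.powers (x i)) M

/-- `d¹ : ⊕_i M_{x_i} → ⊕_{i<j} M_{x_i x_j}`, whose `(i,j)` component is the difference of the
images of the `j`-th and the `i`-th components. -/
def cechD1 : (∀ i : Fin k, Loc M (x i)) →ₗ[R] ∀ p : Pairs k, Loc M (x p.1.1 * x p.1.2) :=
  LinearMap.pi fun p =>
    res M (mul_mem_radical_right (x p.1.1) (x p.1.2)) ∘ₗ LinearMap.proj p.1.2 -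
      res M (mul_mem_radical_left (x p.1.1) (x p.1.2)) ∘ₗ LinearMap.proj p.1.1

theorem res_mkLinearMap {x y : R} (h : x ∈ (Ideal.span {y}).radical) (m : M) :
    res M h (LocalizedModule.mkLinearMap (Submonoid.powers y) M m) =
      LocalizedModule.mkLinearMap (Submonoid.powers x) M m :=
  LinearMap.congr_fun (LocalizedModule.lift_comp (Submonoid.powers y) _
    (isUnit_of_mem_radical M h)) m

theorem cechD1_comp_cechD0 : cechD1 x M ∘ₗ cechD0 x M = 0 := by
  ext m p
  simp only [cechD1, cechD0, LinearMap.comp_apply, LinearMap.pi_apply, LinearMap.sub_apply,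
    LinearMap.proj_apply, res_mkLinearMap, sub_self, LinearMap.zero_apply, Pi.zero_apply]

/-- `Ď⁰_x(M)`, the zeroth cohomology of the global Čech complex
`0 → ⊕_i M_{x_i} → ⊕_{i<j} M_{x_i x_j} → ⋯`. -/
def cechGlobalH0 : Submodule R (∀ i : Fin k, Loc M (x i)) := LinearMap.ker (cechD1 x M)

/-- `Ȟ¹_x(M)`, the first cohomology of the Čech complex
`0 → M → ⊕_i M_{x_i} → ⊕_{i<j} M_{x_i x_j} → ⋯`. -/
abbrev CechH1 : Type (max u w) :=
  ↥(LinearMap.ker (cechD1 x M)) ⧸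
    (LinearMap.range (cechD0 x M)).submoduleOf (LinearMap.ker (cechD1 x M))

end Cech

/-! ### The first Koszul homology -/

section Koszul

variable {R : Type u} [CommRing R] {k : ℕ} (y : Fin k → R)
  (M : Type w) [AddCommGroup M] [Module R M]

/-- The Koszul differential `K₁(y; M) = ⊕_i M e_i → K₀(y; M) = M`, `m e_i ↦ y_i m`. -/
def koszulD1 : (Fin k → M) →ₗ[R] M :=
  ∑ i : Fin k, y i • LinearMap.proj i

/-- The Koszul differential `K₂(y; M) = ⊕_{i<j} M (e_i ∧ e_j) → K₁(y; M) = ⊕_i M e_i`,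
`m (e_i ∧ e_j) ↦ y_i m e_j - y_j m e_i`. -/
def koszulD2 : (Pairs k → M) →ₗ[R] (Fin k → M) :=
  ∑ p : Pairs k,
    (y p.1.1 • LinearMap.single R (fun _ : Fin k => M) p.1.2 -
      y p.1.2 • LinearMap.single R (fun _ : Fin k => M) p.1.1) ∘ₗ LinearMap.proj p

theorem koszulD1_single (i : Fin k) (m : M) : koszulD1 y M (Pi.single i m) = y i • m := by
  simp only [koszulD1, LinearMap.sum_apply, LinearMap.smul_apply, LinearMap.proj_apply]
  rw [Finset.sum_eq_single i]
  · rw [Pi.single_eq_same]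
  · intro j _ hj
    rw [Pi.single_eq_of_ne hj, smul_zero]
  · intro hi
    exact absurd (Finset.mem_univ i) hi

theorem koszulD2_apply (c : Pairs k → M) : koszulD2 y M c =
    ∑ p : Pairs k, (y p.1.1 • (Pi.single p.1.2 (c p) : Fin k → M) -
      y p.1.2 • (Pi.single p.1.1 (c p) : Fin k → M)) := by
  simp only [koszulD2, LinearMap.sum_apply, LinearMap.comp_apply, LinearMap.sub_apply,
    LinearMap.smul_apply, LinearMap.proj_apply, LinearMap.coe_single]

theorem koszulD1_comp_koszulD2 : koszulD1 y M ∘ₗ koszulD2 y M = 0 := by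
  refine LinearMap.ext fun c => ?_
  rw [LinearMap.comp_apply, koszulD2_apply, map_sum, LinearMap.zero_apply]
  refine Finset.sum_eq_zero fun p _ => ?_
  rw [map_sub, map_smul, map_smul, koszulD1_single, koszulD1_single, smul_comm, sub_self]

/-- The first Koszul homology `H₁(y; M)`. -/
abbrev KoszulH1 : Type w :=
  ↥(LinearMap.ker (koszulD1 y M)) ⧸
    (LinearMap.range (koszulD2 y M)).submoduleOf (LinearMap.ker (koszulD1 y M))

variable (x : Fin k → R)

/-- The sequence `x^(n) = x_1^n, …, x_k^n`. -/
abbrev powSeq (n : ℕ) : Fin k → R := fun i => x i ^ n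

/-- The natural map `K₁(x^(m); M) → K₁(x^(n); M)`, `e_i ↦ x_i^(m-n) e_i` (used for `n ≤ m`). -/
def koszulMap1 (n m : ℕ) : (Fin k → M) →ₗ[R] (Fin k → M) :=
  LinearMap.pi fun i => x i ^ (m - n) • LinearMap.proj i

/-- The natural map `K₂(x^(m); M) → K₂(x^(n); M)`,
`e_i ∧ e_j ↦ x_i^(m-n) x_j^(m-n) e_i ∧ e_j` (used for `n ≤ m`). -/
def koszulMap2 (n m : ℕ) : (Pairs k → M) →ₗ[R] (Pairs k → M) :=
  LinearMap.pi fun p => (x p.1.1 ^ (m - n) * x p.1.2 ^ (m - n)) • LinearMap.proj p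

/-- On `K₀` the natural map is the identity. -/
theorem koszulMap_comm1 {n m : ℕ} (h : n ≤ m) :
    koszulD1 (powSeq x n) M ∘ₗ koszulMap1 M x n m = koszulD1 (powSeq x m) M := by
  refine LinearMap.ext fun c => ?_
  simp only [koszulD1, koszulMap1, LinearMap.comp_apply, LinearMap.sum_apply,
    LinearMap.smul_apply, LinearMap.proj_apply, LinearMap.pi_apply, smul_smul, powSeq]
  refine Finset.sum_congr rfl fun i _ => ?_
  rw [← pow_add, Nat.add_sub_cancel' h]

theorem koszulMap1_single (n m : ℕ) (i : Fin k) (a : M) :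
    koszulMap1 M x n m (Pi.single i a) = x i ^ (m - n) • Pi.single i a := by
  funext j
  simp only [koszulMap1, LinearMap.pi_apply, LinearMap.smul_apply, LinearMap.proj_apply,
    Pi.smul_apply]
  by_cases hj : j = i
  · rw [hj]
  · rw [Pi.single_eq_of_ne hj, smul_zero, smul_zero]

theorem koszulMap_comm2 {n m : ℕ} (h : n ≤ m) :
    koszulMap1 M x n m ∘ₗ koszulD2 (powSeq x m) M =
      koszulD2 (powSeq x n) M ∘ₗ koszulMap2 M x n m := by
  refine LinearMap.ext fun c => ?_
  rw [LinearMap.comp_apply, LinearMap.comp_apply, koszulD2_apply, koszulD2_apply, map_sum]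
  refine Finset.sum_congr rfl fun p _ => ?_
  have e : ∀ i, x i ^ m = x i ^ n * x i ^ (m - n) := fun i => by
    rw [← pow_add, Nat.add_sub_cancel' h]
  simp only [koszulMap2, LinearMap.pi_apply, LinearMap.smul_apply, LinearMap.proj_apply,
    Pi.single_smul, map_sub, map_smul, koszulMap1_single, smul_smul, powSeq, e]
  congr 2 <;> ring

/-- The natural map on cycles. -/
def koszulCyclesMap {n m : ℕ} (h : n ≤ m) :
    ↥(LinearMap.ker (koszulD1 (powSeq x m) M)) →ₗ[R]
      ↥(LinearMap.ker (koszulD1 (powSeq x n) M)) :=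
  (koszulMap1 M x n m).restrict fun c hc => by
    rw [LinearMap.mem_ker, ← LinearMap.comp_apply, koszulMap_comm1 M x h]
    exact hc

/-- The natural map `H₁(x^(m); M) → H₁(x^(n); M)` for `n ≤ m`. -/
def koszulH1Map {n m : ℕ} (h : n ≤ m) :
    KoszulH1 (powSeq x m) M →ₗ[R] KoszulH1 (powSeq x n) M :=
  Submodule.mapQ _ _ (koszulCyclesMap M x h) <| by
    rintro ⟨_, hc⟩ ⟨b, rfl⟩
    exact ⟨koszulMap2 M x n m b, (LinearMap.congr_fun (koszulMap_comm2 M x h) b).symm⟩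

/-- The inverse system `{H₁(x^(n); R)}_{n ≥ 1}` is pro-zero. -/
def KoszulH1ProZero : Prop :=
  ∀ n : ℕ, 1 ≤ n → ∃ (m : ℕ) (h : n ≤ m), koszulH1Map R x h = 0

end Koszul

/-! ### The homomorphisms of the triangle -/

section Maps

variable {R : Type u} [CommRing R]

/-- `φ ↦ (φ(x^n) / x^n)_{x ∈ J}` for `φ ∈ Hom_R(J^n, M)`. -/
def thetaAux (J : Ideal R) (M : Type w) [AddCommGroup M] [Module R M] (n : ℕ) :
    (↥(J ^ n) →ₗ[R] M) →ₗ[R] limLoc M J where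
  toFun φ := ⟨fun x => frac (x : R) (φ ⟨(x : R) ^ n, Ideal.pow_mem_pow x.2 n⟩) n, by
    intro x y h
    obtain ⟨k, hk⟩ := h
    obtain ⟨r, hr⟩ := Ideal.mem_span_singleton.1 hk
    rw [res_frac M ⟨k, hk⟩ hr, LocalizedModule.mk_eq]
    refine ⟨1, ?_⟩
    simp only [one_smul, Submonoid.smul_def, ← map_smul]
    congr 1
    ext
    simp only [SetLike.val_smul, smul_eq_mul]
    rw [pow_mul, hr]
    ring⟩
  map_add' φ ψ := by
    ext x
    simp only [LinearMap.add_apply, Submodule.coe_add, Pi.add_apply, frac,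
      LocalizedModule.mk_add_mk, LocalizedModule.mk_eq]
    exact ⟨1, by simp only [← smul_add, smul_smul]⟩
  map_smul' r φ := by
    ext x
    simp only [LinearMap.smul_apply, RingHom.id_apply, SetLike.val_smul, Pi.smul_apply,
      LocalizedModule.smul'_mk]

/-- `θ_M : D_J(M) → lim←_{x ∈ J} M_x`, `φ ↦ (φ_n(x^n) / x^n)_{x ∈ J}`, where
`φ_n ∈ Hom_R(J^n, M)` represents `φ`. -/
def theta (J : Ideal R) (M : Type w) [AddCommGroup M] [Module R M] :
    IdealTransform J M →ₗ[R] limLoc M J :=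
  Module.DirectLimit.lift R ℕ _ _ (thetaAux J M) <| by
    intro n m h φ
    ext x
    simp only [thetaAux, LinearMap.coe_mk, AddHom.coe_mk, homRestrict, LinearMap.lcomp_apply,
      LocalizedModule.mk_eq]
    refine ⟨1, ?_⟩
    simp only [one_smul, Submonoid.smul_def, ← map_smul]
    congr 1
    ext
    simp only [SetLike.val_smul, smul_eq_mul, Submodule.coe_inclusion]
    ring

variable {k : ℕ} (x : Fin k → R)

/-- The ideal `J = (x_1, …, x_k)R`. -/
abbrev genIdeal : Ideal R := Ideal.span (Set.range x)

theorem mem_genIdeal (i : Fin k) : x i ∈ genIdeal x := Ideal.subset_span ⟨i, rfl⟩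

/-- `φ ↦ (φ(x_i^n) / x_i^n)_i` for `φ ∈ Hom_R(J^n, M)`. -/
def rhoAux (M : Type w) [AddCommGroup M] [Module R M] (n : ℕ) :
    (↥(genIdeal x ^ n) →ₗ[R] M) →ₗ[R] cechGlobalH0 x M where
  toFun φ := ⟨fun i => frac (x i) (φ ⟨x i ^ n, Ideal.pow_mem_pow (mem_genIdeal x i) n⟩) n, by
    refine LinearMap.mem_ker.2 (funext fun p => ?_)
    simp only [cechD1, LinearMap.pi_apply, LinearMap.sub_apply, LinearMap.comp_apply,
      LinearMap.proj_apply, Pi.zero_apply, sub_eq_zero]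
    rw [res_frac (k := 1) (r := x p.1.1) M _ (by ring),
      res_frac (k := 1) (r := x p.1.2) M _ (by ring), LocalizedModule.mk_eq]
    refine ⟨1, ?_⟩
    simp only [one_smul, Submonoid.smul_def, ← map_smul]
    congr 1
    ext
    simp only [SetLike.val_smul, smul_eq_mul]
    ring⟩
  map_add' φ ψ := by
    ext i
    simp only [LinearMap.add_apply, Submodule.coe_add, Pi.add_apply, frac,
      LocalizedModule.mk_add_mk, LocalizedModule.mk_eq]
    exact ⟨1, by simp only [← smul_add, smul_smul]⟩
  map_smul' r φ := by
    ext i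
    simp only [LinearMap.smul_apply, RingHom.id_apply, SetLike.val_smul, Pi.smul_apply,
      LocalizedModule.smul'_mk]

/-- `ρ_M : D_J(M) → Ď⁰_x(M)`, `φ ↦ (φ_n(x_i^n) / x_i^n)_i`, where `φ_n ∈ Hom_R(J^n, M)`
represents `φ`. -/
def rho (M : Type w) [AddCommGroup M] [Module R M] :
    IdealTransform (genIdeal x) M →ₗ[R] cechGlobalH0 x M :=
  Module.DirectLimit.lift R ℕ _ _ (rhoAux x M) <| by
    intro n m h φ
    ext i
    simp only [rhoAux, LinearMap.coe_mk, AddHom.coe_mk, homRestrict, LinearMap.lcomp_apply,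
      LocalizedModule.mk_eq]
    refine ⟨1, ?_⟩
    simp only [one_smul, Submonoid.smul_def, ← map_smul]
    congr 1
    ext
    simp only [SetLike.val_smul, smul_eq_mul, Submodule.coe_inclusion]
    ring

/-- `σ_M : lim←_{x ∈ J} M_x → Ď⁰_x(M)`, `f ↦ (f_{x_i})_i`. -/
def sigma (M : Type w) [AddCommGroup M] [Module R M] :
    limLoc M (genIdeal x) →ₗ[R] cechGlobalH0 x M where
  toFun f := ⟨fun i => f.1 ⟨x i, mem_genIdeal x i⟩, by
    refine LinearMap.mem_ker.2 (funext fun p => ?_)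
    simp only [cechD1, LinearMap.pi_apply, LinearMap.sub_apply, LinearMap.comp_apply,
      LinearMap.proj_apply, Pi.zero_apply, sub_eq_zero]
    have hp : x p.1.1 * x p.1.2 ∈ genIdeal x := Ideal.mul_mem_left _ _ (mem_genIdeal x p.1.2)
    exact (f.2 ⟨_, hp⟩ ⟨_, mem_genIdeal x p.1.2⟩ (mul_mem_radical_right _ _)).trans
      (f.2 ⟨_, hp⟩ ⟨_, mem_genIdeal x p.1.1⟩ (mul_mem_radical_left _ _)).symm⟩
  map_add' _ _ := rfl
  map_smul' _ _ := rfl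

end Maps

end Deligne

end

/-! Since `ρ = σ ∘ θ` and `σ` is bijective, every claim about `θ` reduces to one about `ρ`. The
recurring tool is that an ideal containing a power of each `x_i` has `J` in its radical and, `J`
being finitely generated, contains a power of `J`. Applied to annihilators and to the kernel of some
`φ : J^n → M`, it gives injectivity of `σ` and of `ρ`.

For part 2, `a • [φ]` is the image of `φ a` under `M → D_J(M)` (`smul_idealTransformOf`), so each
element of the kernel or cokernel of this map is killed by a power of `J`. Localizing at any `y ∈ J`
makes it bijective, so the Čech complexes of `M` and `D_J(M)` agree from degree 1 on, and `ρ`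
becomes `d⁰` of `D_J(M)` (`locMap_rho`).

For part 3, a cocycle is a family with `x_j^n m_i = x_i^n m_j`, that is, a map to `M` from the
cokernel of the Koszul `d₂` of `x^(n)`. It lies in the image of `ρ` once `e_i ↦ x_i^(m-n) m_i` kills
the cycles of `x^(m)` for some `m`, thus descending to the ideal `(x^(m))`. Pro-vanishing ensures
this; conversely, the universal cocycle, with values in that cokernel, forces pro-vanishing. -/

namespace Deligne

/-! ### Arithmetic of fractions and functoriality of localization -/

section Fractions

variable {R : Type u} [CommRing R] {M : Type w} [AddCommGroup M] [Module R M]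
  {N : Type v} [AddCommGroup N] [Module R N]

theorem frac_eq_iff {x : R} {m m' : M} {n n' : ℕ} :
    frac x m n = frac x m' n' ↔ ∃ N : ℕ, x ^ N • x ^ n' • m = x ^ N • x ^ n • m' := by
  rw [LocalizedModule.mk_eq]
  constructor
  · rintro ⟨⟨_, N, rfl⟩, h⟩
    exact ⟨N, h⟩
  · rintro ⟨N, h⟩
    exact ⟨⟨x ^ N, N, rfl⟩, h⟩

theorem exists_eq_frac {x : R} (z : Loc M x) : ∃ (m : M) (n : ℕ), z = frac x m n := by
  induction z using LocalizedModule.induction_on with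
  | h m s =>
    obtain ⟨_, n, rfl⟩ := s
    exact ⟨m, n, rfl⟩

theorem frac_eq_frac_pow_smul (x : R) (m : M) (n N : ℕ) :
    frac x m n = frac x (x ^ N • m) (N + n) :=
  frac_eq_iff.2 ⟨0, by rw [pow_add, mul_comm, mul_smul]⟩

theorem frac_eq_zero_iff {x : R} {m : M} {n : ℕ} :
    frac x m n = 0 ↔ ∃ N : ℕ, x ^ N • m = 0 := by
  have h : (0 : Loc M x) = frac x 0 0 := (LocalizedModule.zero_mk _).symm
  rw [h, frac_eq_iff]
  simp only [pow_zero, one_smul, smul_zero]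

theorem smul_frac (a x : R) (m : M) (n : ℕ) : a • frac x m n = frac x (a • m) n := by
  rw [LocalizedModule.smul'_mk]

theorem pow_smul_frac (x : R) (m : M) (n : ℕ) : x ^ n • frac x m n = frac x m 0 := by
  rw [smul_frac, frac_eq_iff]
  exact ⟨0, by simp⟩

theorem pow_smul_left_injective (x : R) (n : ℕ) :
    Function.Injective fun z : Loc M x => x ^ n • z :=
  IsLocalizedModule.smul_injective (LocalizedModule.mkLinearMap (Submonoid.powers x) M)
    (⟨x ^ n, n, rfl⟩ : Submonoid.powers x)

theorem mkLinearMap_eq_frac (x : R) (m : M) :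
    LocalizedModule.mkLinearMap (Submonoid.powers x) M m = frac x m 0 := by
  rw [LocalizedModule.mkLinearMap_apply]
  exact LocalizedModule.mk_eq.2 ⟨1, by simp [Submonoid.smul_def]⟩

theorem res_frac_zero {x y : R} (h : x ∈ (Ideal.span {y}).radical) (m : M) :
    res M h (frac y m 0) = frac x m 0 := by
  rw [← mkLinearMap_eq_frac, ← mkLinearMap_eq_frac, res_mkLinearMap]

/-- The map `M_x → N_x` induced by `f : M → N`. -/
noncomputable def locMap (x : R) (f : M →ₗ[R] N) : Loc M x →ₗ[R] Loc N x :=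
  (LocalizedModule.map (Submonoid.powers x) f).restrictScalars R

theorem locMap_frac (x : R) (f : M →ₗ[R] N) (m : M) (n : ℕ) :
    locMap x f (frac x m n) = frac x (f m) n :=
  LocalizedModule.map_mk (Submonoid.powers x) f m _

theorem locMap_res {x y : R} (h : x ∈ (Ideal.span {y}).radical) (f : M →ₗ[R] N) (z : Loc M y) :
    locMap x f (res M h z) = res N h (locMap y f z) := by
  obtain ⟨m, n, rfl⟩ := exists_eq_frac z
  obtain ⟨k, hk⟩ := h
  obtain ⟨r, hr⟩ := Ideal.mem_span_singleton.1 hk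
  rw [locMap_frac, res_frac M ⟨k, hk⟩ hr, res_frac N ⟨k, hk⟩ hr, locMap_frac, map_smul]

theorem locMap_injective {x : R} {f : M →ₗ[R] N}
    (hf : ∀ m, f m = 0 → ∃ n : ℕ, x ^ n • m = 0) : Function.Injective (locMap x f) := by
  refine (injective_iff_map_eq_zero _).2 fun z hz => ?_
  obtain ⟨m, n, rfl⟩ := exists_eq_frac z
  rw [locMap_frac, frac_eq_zero_iff] at hz
  obtain ⟨a, ha⟩ := hz
  obtain ⟨b, hb⟩ := hf (x ^ a • m) (by rw [map_smul, ha])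
  exact frac_eq_zero_iff.2 ⟨b + a, by rw [pow_add, mul_smul, hb]⟩

theorem locMap_surjective {x : R} {f : M →ₗ[R] N}
    (hf : ∀ y, ∃ (n : ℕ) (m : M), x ^ n • y = f m) : Function.Surjective (locMap x f) := by
  intro z
  obtain ⟨y, l, rfl⟩ := exists_eq_frac z
  obtain ⟨n, m, h⟩ := hf y
  exact ⟨frac x m (n + l), by rw [locMap_frac, ← h, ← frac_eq_frac_pow_smul]⟩

end Fractions

/-! ### Powers of the generators, and representatives of Čech cocycles -/

section Generators

variable {R : Type u} [CommRing R] {k : ℕ} (x : Fin k → R)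
  {M : Type w} [AddCommGroup M] [Module R M]

theorem genIdeal_fg : (genIdeal x).FG := Submodule.fg_span (Set.finite_range x)

variable {x}

theorem genIdeal_le_radical {I : Ideal R} (h : ∀ i, ∃ n : ℕ, x i ^ n ∈ I) :
    genIdeal x ≤ I.radical :=
  Ideal.span_le.2 <| Set.range_subset_iff.2 h

/-- Finite generation of `J` turns containment in a radical into containment of one power, without
any Noetherian assumption. -/
theorem exists_genIdeal_pow_le {I : Ideal R} (h : ∀ i, ∃ n : ℕ, x i ^ n ∈ I) :
    ∃ L : ℕ, genIdeal x ^ L ≤ I :=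
  Ideal.exists_pow_le_of_le_radical_of_fg (genIdeal_le_radical h) (genIdeal_fg x)

theorem range_koszulD1 (y : Fin k → R) : LinearMap.range (koszulD1 y R) = genIdeal y := by
  apply le_antisymm
  · rintro _ ⟨c, rfl⟩
    simp only [koszulD1, LinearMap.sum_apply, LinearMap.smul_apply, LinearMap.proj_apply]
    exact Ideal.sum_mem _ fun i _ => Ideal.mul_mem_right _ _ (mem_genIdeal y i)
  · refine Ideal.span_le.2 (Set.range_subset_iff.2 fun i => ?_)
    exact ⟨Pi.single i 1, by rw [koszulD1_single, smul_eq_mul, mul_one]⟩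

/-- For `y ∈ J`, the elements of `M_y` are separated by multiplication with powers of the
generators of `J`. -/
theorem loc_eq_zero_of_pow_smul {y : R} (hy : y ∈ genIdeal x) {z : Loc M y}
    (h : ∀ i, ∃ n : ℕ, x i ^ n • z = 0) : z = 0 := by
  -- The annihilator of `z` contains a power of each generator, hence a power of `y`, which acts
  -- injectively on `M_y`.
  obtain ⟨t, ht⟩ :=
    genIdeal_le_radical (I := LinearMap.ker (LinearMap.toSpanSingleton R _ z)) h hy
  exact pow_smul_left_injective y t (ht.trans (smul_zero _).symm)

/-- Degree zero Čech cocycles are given by `m_i / x_i^n` with `x_j^n m_i = x_i^n m_j`. -/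
theorem cechGlobalH0_exists_rep {c : ∀ i, Loc M (x i)} (hc : c ∈ cechGlobalH0 x M) :
    ∃ (n : ℕ) (m : Fin k → M), (∀ i, c i = frac (x i) (m i) n) ∧
      ∀ i j, x j ^ n • m i = x i ^ n • m j := by
  choose m₀ n₀ h₀ using fun i => exists_eq_frac (c i)
  obtain ⟨a, ha⟩ : ∃ a, ∀ i, n₀ i ≤ a :=
    ⟨Finset.univ.sup n₀, fun i => Finset.le_sup (Finset.mem_univ i)⟩
  set m₁ : Fin k → M := fun i => x i ^ (a - n₀ i) • m₀ i
  have h₁ : ∀ i, c i = frac (x i) (m₁ i) a := fun i => by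
    rw [h₀, frac_eq_frac_pow_smul _ _ _ (a - n₀ i), Nat.sub_add_cancel (ha i)]
  have h₂ : ∀ p : Pairs k, ∃ N : ℕ, (x p.1.1 * x p.1.2) ^ N • x p.1.1 ^ a • m₁ p.1.2 =
      (x p.1.1 * x p.1.2) ^ N • x p.1.2 ^ a • m₁ p.1.1 := fun p => by
    have := congr_fun (LinearMap.mem_ker.1 hc) p
    simp only [cechD1, LinearMap.pi_apply, LinearMap.sub_apply, LinearMap.comp_apply,
      LinearMap.proj_apply, Pi.zero_apply, sub_eq_zero] at this
    rw [h₁, h₁, res_frac (k := 1) (r := x p.1.1) M _ (by ring),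
      res_frac (k := 1) (r := x p.1.2) M _ (by ring), frac_eq_iff] at this
    obtain ⟨N, hN⟩ := this
    -- The common denominator `(x_i x_j)^(1 * a)` is absorbed into the power that witnesses
    -- equality.
    exact ⟨N + 1 * a, by simpa only [pow_add, mul_smul] using hN⟩
  choose N₀ hN₀ using h₂
  obtain ⟨N, hN⟩ : ∃ N, ∀ p, N₀ p ≤ N :=
    ⟨Finset.univ.sup N₀, fun p => Finset.le_sup (Finset.mem_univ p)⟩
  have h₃ : ∀ i j, i < j → x j ^ (N + a) • x i ^ N • m₁ i = x i ^ (N + a) • x j ^ N • m₁ j := by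
    intro i j hij
    have h := congr_arg (fun z => (x i * x j) ^ (N - N₀ ⟨(i, j), hij⟩) • z) (hN₀ ⟨(i, j), hij⟩)
    simp only [smul_smul] at h ⊢
    simp only [← mul_assoc, ← pow_add, Nat.sub_add_cancel (hN ⟨(i, j), hij⟩)] at h
    convert h.symm using 2 <;> ring
  refine ⟨N + a, fun i => x i ^ N • m₁ i, fun i => ?_, fun i j => ?_⟩
  · rw [h₁, ← frac_eq_frac_pow_smul]
  · rcases lt_trichotomy i j with h | rfl | h
    · exact h₃ i j h
    · rfl
    · exact (h₃ j i h).symm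

theorem frac_mem_cechGlobalH0 {n : ℕ} {m : Fin k → M}
    (h : ∀ i j, x j ^ n • m i = x i ^ n • m j) :
    (fun i => frac (x i) (m i) n) ∈ cechGlobalH0 x M := by
  refine LinearMap.mem_ker.2 (funext fun p => ?_)
  simp only [cechD1, LinearMap.pi_apply, LinearMap.sub_apply, LinearMap.comp_apply,
    LinearMap.proj_apply, Pi.zero_apply, sub_eq_zero]
  rw [res_frac (k := 1) (r := x p.1.1) M _ (by ring),
    res_frac (k := 1) (r := x p.1.2) M _ (by ring), h]

end Generators

/-! ### Bijectivity of `σ` -/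

section Sigma

variable {R : Type u} [CommRing R] {k : ℕ} (x : Fin k → R)
  (M : Type w) [AddCommGroup M] [Module R M]

/-- Both `f_y` and `f_{x_i}` restrict to the component of `f` in `M_{y x_i}`. If `f_{x_i} = 0`, a
power of `x_i` therefore kills `f_y`. -/
theorem sigma_injective : Function.Injective (sigma x M) := by
  refine (injective_iff_map_eq_zero _).2 fun f hf => Subtype.ext (funext fun y => ?_)
  refine loc_eq_zero_of_pow_smul y.2 fun i => ?_
  have hfi : f.1 ⟨x i, mem_genIdeal x i⟩ = 0 := congr_fun (congr_arg Subtype.val hf) i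
  have hyx : (y : R) * x i ∈ genIdeal x := Ideal.mul_mem_left _ _ (mem_genIdeal x i)
  have h := (f.2 ⟨_, hyx⟩ y (mul_mem_radical_left _ _)).trans
    (f.2 ⟨_, hyx⟩ ⟨x i, mem_genIdeal x i⟩ (mul_mem_radical_right _ _)).symm
  rw [hfi, map_zero] at h
  obtain ⟨m, l, hm⟩ := exists_eq_frac (f.1 y)
  rw [hm, res_frac (k := 1) (r := x i) M _ (by ring), frac_eq_zero_iff] at h
  obtain ⟨N, hN⟩ := h
  refine ⟨N + l, ?_⟩
  rw [hm, smul_frac, frac_eq_zero_iff]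
  exact ⟨N, by rw [← hN, smul_smul, smul_smul]; congr 1; ring⟩

/-- The equations `x_j^n z = m_j / 1` for all `j` have exactly one solution in each `M_y`.
Restriction maps preserve them, so uniqueness yields both compatibility and the prescribed
components. -/
theorem sigma_surjective : Function.Surjective (sigma x M) := by
  rintro ⟨c, hc⟩
  obtain ⟨n, m, hcm, hm⟩ := cechGlobalH0_exists_rep hc
  have hex : ∀ y : genIdeal x, ∃ z : Loc M (y : R), ∀ j, x j ^ n • z = frac (y : R) (m j) 0 := by
    intro y
    obtain ⟨t, ht⟩ := genIdeal_le_radical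
      (I := genIdeal (powSeq x n)) (fun i => ⟨n, mem_genIdeal (powSeq x n) i⟩) y.2
    obtain ⟨r, hr⟩ := range_koszulD1 (powSeq x n) ▸ ht
    -- Here `y^t = ∑ r_i x_i^n`, so the cocycle relation gives `x_j^n ∑ r_i m_i = y^t m_j`.
    refine ⟨frac (y : R) (∑ i, r i • m i) t, fun j => ?_⟩
    rw [smul_frac, ← pow_smul_frac (y : R) (m j) t, smul_frac, ← hr]
    congr 1
    simp only [koszulD1, LinearMap.sum_apply, LinearMap.smul_apply, LinearMap.proj_apply,
      Finset.smul_sum, Finset.sum_smul]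
    refine Finset.sum_congr rfl fun i _ => ?_
    rw [smul_comm, hm, smul_smul, smul_eq_mul, mul_comm]
  have huniq : ∀ (y : genIdeal x) (z z' : Loc M (y : R)),
      (∀ j, x j ^ n • z = frac (y : R) (m j) 0) → (∀ j, x j ^ n • z' = frac (y : R) (m j) 0) →
      z = z' := fun y z z' hz hz' =>
    sub_eq_zero.1 <| loc_eq_zero_of_pow_smul y.2 fun j =>
      ⟨n, by rw [smul_sub, hz, hz', sub_self]⟩
  choose f hf using hex
  refine ⟨⟨f, fun y y' h => huniq y _ _ (fun j => ?_) (hf y)⟩, Subtype.ext (funext fun i => ?_)⟩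
  · rw [← map_smul, hf, res_frac_zero]
  · refine huniq ⟨x i, mem_genIdeal x i⟩ _ _ (hf _) fun j => ?_
    change x j ^ n • c i = _
    rw [hcm, smul_frac, hm, ← smul_frac, pow_smul_frac]

theorem sigma_bijective : Function.Bijective (sigma x M) :=
  ⟨sigma_injective x M, sigma_surjective x M⟩

end Sigma

end Deligne

namespace Deligne

/-! ### The map `M → D_J(M)` and its localizations -/

section IdealTransform

variable {R : Type u} [CommRing R] (J : Ideal R) (M : Type w) [AddCommGroup M] [Module R M]

instance : DirectedSystem (fun n : ℕ => ↥(J ^ n) →ₗ[R] M) (homRestrict J M · · ·) where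
  map_self _ _ := rfl
  map_map _ _ _ _ _ _ := rfl

/-- The class in `D_J(M)` of a homomorphism `J^n → M`. -/
noncomputable abbrev idealTransformOf (n : ℕ) : (↥(J ^ n) →ₗ[R] M) →ₗ[R] IdealTransform J M :=
  Module.DirectLimit.of R ℕ _ (homRestrict J M) n

/-- The canonical map `M → D_J(M)`, which sends `m` to the multiplication `a ↦ a m`. -/
noncomputable def toIdealTransform : M →ₗ[R] IdealTransform J M :=
  idealTransformOf J M 0 ∘ₗ LinearMap.lcomp R M (J ^ 0).subtype ∘ₗ (LinearMap.lsmul R M).flip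

variable {J M}

theorem toIdealTransform_apply (m : M) (n : ℕ) :
    toIdealTransform J M m =
      idealTransformOf J M n ((LinearMap.lsmul R M).flip m ∘ₗ (J ^ n).subtype) :=
  (Module.DirectLimit.of_f (hij := Nat.zero_le n)).symm

/-- On `J^n` one has `a φ(b) = φ(ab) = b φ(a)`. Hence the cokernel of `M → D_J(M)` is `J`-torsion.
-/
theorem smul_idealTransformOf {n : ℕ} (φ : ↥(J ^ n) →ₗ[R] M) (a : ↥(J ^ n)) :
    (a : R) • idealTransformOf J M n φ = toIdealTransform J M (φ a) := by
  rw [toIdealTransform_apply _ n, ← map_smul]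
  congr 1
  ext b
  change (a : R) • φ b = (b : R) • φ a
  rw [← map_smul, ← map_smul]
  congr 1
  exact Subtype.ext (mul_comm _ _)

theorem exists_pow_smul_of_toIdealTransform_eq_zero {m : M} (h : toIdealTransform J M m = 0) :
    ∃ n : ℕ, ∀ a ∈ J ^ n, a • m = 0 := by
  rw [toIdealTransform_apply _ 0] at h
  obtain ⟨n, hn, h⟩ := Module.DirectLimit.of.zero_exact h
  exact ⟨n, fun a ha => LinearMap.congr_fun h ⟨a, ha⟩⟩

theorem locMap_toIdealTransform_bijective {y : R} (hy : y ∈ J) :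
    Function.Bijective (locMap y (toIdealTransform J M)) := by
  constructor
  · refine locMap_injective fun m hm => ?_
    obtain ⟨n, hn⟩ := exists_pow_smul_of_toIdealTransform_eq_zero hm
    exact ⟨n, hn _ (Ideal.pow_mem_pow hy n)⟩
  · refine locMap_surjective fun ψ => ?_
    obtain ⟨n, φ, rfl⟩ := Module.DirectLimit.exists_of ψ
    exact ⟨n, _, smul_idealTransformOf φ ⟨y ^ n, Ideal.pow_mem_pow hy n⟩⟩

end IdealTransform

/-! ### Injectivity of `ρ` and the Čech criterion -/

section Rho

variable {R : Type u} [CommRing R] {k : ℕ} (x : Fin k → R)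
  (M : Type w) [AddCommGroup M] [Module R M]

theorem rho_of_apply (n : ℕ) (φ : ↥(genIdeal x ^ n) →ₗ[R] M) (i : Fin k) :
    (rho x M (idealTransformOf (genIdeal x) M n φ)).1 i =
      frac (x i) (φ ⟨x i ^ n, Ideal.pow_mem_pow (mem_genIdeal x i) n⟩) n := by
  rw [rho, Module.DirectLimit.lift_of]
  rfl

theorem rho_eq_sigma_comp_theta : rho x M = sigma x M ∘ₗ theta (genIdeal x) M := by
  refine Module.DirectLimit.hom_ext fun n => LinearMap.ext fun φ => ?_
  simp only [LinearMap.comp_apply, rho, theta, Module.DirectLimit.lift_of]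
  rfl

theorem rho_injective : Function.Injective (rho x M) := by
  refine (injective_iff_map_eq_zero _).2 fun ψ hψ => ?_
  obtain ⟨n, φ, rfl⟩ := Module.DirectLimit.exists_of ψ
  -- Viewed as an ideal of `R`, `ker φ` contains a power of each `x_i`, hence some `J^L`; so `φ`
  -- restricts to zero on `J^(max n L)`.
  obtain ⟨L, hL⟩ := exists_genIdeal_pow_le (x := x)
      (I := (LinearMap.ker φ).map (genIdeal x ^ n).subtype) fun i => by
    have h := congr_fun (congr_arg Subtype.val hψ) i
    rw [rho_of_apply] at h
    obtain ⟨N, hN⟩ := frac_eq_zero_iff.1 h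
    exact ⟨N + n, ⟨x i ^ N • ⟨x i ^ n, Ideal.pow_mem_pow (mem_genIdeal x i) n⟩,
      (map_smul φ _ _).trans hN, by simp [pow_add]⟩⟩
  rw [← Module.DirectLimit.of_f (hij := le_max_left n L),
    show homRestrict (genIdeal x) M n (max n L) (le_max_left n L) φ = 0 from ?_, map_zero]
  ext a
  obtain ⟨b, hb, hba⟩ := hL (Ideal.pow_le_pow_right (le_max_right n L) a.2)
  have : Submodule.inclusion (Ideal.pow_le_pow_right (le_max_left n L)) a = b :=
    Subtype.ext hba.symm
  rw [homRestrict, LinearMap.lcomp_apply, this]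
  exact hb

theorem theta_injective : Function.Injective (theta (genIdeal x) M) :=
  Function.Injective.of_comp (f := sigma x M) <| by
    rw [← LinearMap.coe_comp, ← rho_eq_sigma_comp_theta]
    exact rho_injective x M

theorem theta_bijective_iff_rho_bijective :
    Function.Bijective (theta (genIdeal x) M) ↔ Function.Bijective (rho x M) := by
  rw [rho_eq_sigma_comp_theta, LinearMap.coe_comp]
  exact (Function.Bijective.of_comp_iff' (sigma_bijective x M) _).symm

theorem subsingleton_cechH1_iff :
    Subsingleton (CechH1 x M) ↔ cechGlobalH0 x M ≤ LinearMap.range (cechD0 x M) := by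
  rw [Submodule.Quotient.subsingleton_iff, Submodule.submoduleOf_eq_top]
  rfl

variable {M} in
theorem locMap_rho (ψ : IdealTransform (genIdeal x) M) (i : Fin k) :
    locMap (x i) (toIdealTransform (genIdeal x) M) ((rho x M ψ).1 i) =
      cechD0 x (IdealTransform (genIdeal x) M) ψ i := by
  obtain ⟨n, φ, rfl⟩ := Module.DirectLimit.exists_of ψ
  rw [rho_of_apply, locMap_frac,
    ← smul_idealTransformOf φ ⟨x i ^ n, Ideal.pow_mem_pow (mem_genIdeal x i) n⟩]
  exact (frac_eq_frac_pow_smul _ _ 0 n).symm.trans (mkLinearMap_eq_frac _ _).symm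

variable {M} in
-- Cocycle conditions live in the localizations at `x_i x_j ∈ J`, where `M → D_J(M)` induces an
-- injection.
theorem locMap_mem_cechGlobalH0_iff (c : ∀ i, Loc M (x i)) :
    (fun i => locMap (x i) (toIdealTransform (genIdeal x) M) (c i)) ∈
      cechGlobalH0 x (IdealTransform (genIdeal x) M) ↔ c ∈ cechGlobalH0 x M := by
  simp only [cechGlobalH0, LinearMap.mem_ker, funext_iff, cechD1, LinearMap.pi_apply,
    LinearMap.sub_apply, LinearMap.comp_apply, LinearMap.proj_apply, Pi.zero_apply, sub_eq_zero,
    ← locMap_res]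
  refine forall_congr' fun p => Function.Injective.eq_iff ?_
  exact (locMap_toIdealTransform_bijective
    (Ideal.mul_mem_left _ _ (mem_genIdeal x p.1.2))).1

theorem rho_bijective_iff_subsingleton_cechH1 :
    Function.Bijective (rho x M) ↔
      Subsingleton (CechH1 x (IdealTransform (genIdeal x) M)) := by
  rw [subsingleton_cechH1_iff]
  constructor
  · intro h c hc
    choose c' hc' using fun i =>
      (locMap_toIdealTransform_bijective (M := M) (mem_genIdeal x i)).2 (c i)
    obtain rfl := funext hc'
    obtain ⟨ψ, hψ⟩ := h.2 ⟨c', (locMap_mem_cechGlobalH0_iff x c').1 hc⟩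
    refine ⟨ψ, funext fun i => ?_⟩
    rw [← locMap_rho, hψ]
  · refine fun h => ⟨rho_injective x M, fun c => ?_⟩
    obtain ⟨ψ, hψ⟩ := h ((locMap_mem_cechGlobalH0_iff x c.1).2 c.2)
    refine ⟨ψ, Subtype.ext (funext fun i => ?_)⟩
    refine (locMap_toIdealTransform_bijective (M := M) (mem_genIdeal x i)).1 ?_
    rw [locMap_rho, hψ]

end Rho

/-! ### Pro-vanishing of Koszul homology -/

section ProZero

variable {R : Type u} [CommRing R] {k : ℕ} (x : Fin k → R)

theorem koszulH1Map_eq_zero_iff {n m : ℕ} (h : n ≤ m) :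
    koszulH1Map R x h = 0 ↔ ∀ c, koszulD1 (powSeq x m) R c = 0 →
      koszulMap1 R x n m c ∈ LinearMap.range (koszulD2 (powSeq x n) R) := by
  constructor
  · intro h0 c hc
    have := LinearMap.congr_fun h0 (Submodule.Quotient.mk ⟨c, hc⟩)
    exact (Submodule.Quotient.mk_eq_zero
      ((LinearMap.range (koszulD2 (powSeq x n) R)).submoduleOf _)).1 this
  · intro h0
    refine LinearMap.ext fun z => ?_
    obtain ⟨c, rfl⟩ := Submodule.Quotient.mk_surjective _ z
    exact (Submodule.Quotient.mk_eq_zero _).2 (h0 c.1 c.2)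

/-- A homomorphism out of an ideal, prescribed on the generators and killing the relations. -/
theorem exists_linearMap_of_ker_koszulD1_le {M : Type w} [AddCommGroup M] [Module R M]
    (y : Fin k → R) {ψ : (Fin k → R) →ₗ[R] M}
    (h : LinearMap.ker (koszulD1 y R) ≤ LinearMap.ker ψ) :
    ∃ φ : ↥(genIdeal y) →ₗ[R] M, ∀ c (hc : koszulD1 y R c ∈ genIdeal y),
      φ ⟨koszulD1 y R c, hc⟩ = ψ c := by
  rw [← range_koszulD1]
  refine ⟨Submodule.liftQ _ ψ h ∘ₗ (koszulD1 y R).quotKerEquivRange.symm.toLinearMap,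
    fun c hc => ?_⟩
  rw [LinearMap.comp_apply, LinearEquiv.coe_coe, LinearMap.quotKerEquivRange_symm_apply_image]
  rfl

theorem rho_surjective_of_proZero (hx : KoszulH1ProZero x)
    (M : Type w) [AddCommGroup M] [Module R M] : Function.Surjective (rho x M) := by
  rintro ⟨c, hc⟩
  obtain ⟨n₀, m₀, hc₀, hm₀⟩ := cechGlobalH0_exists_rep hc
  obtain ⟨n, μ, hn, hcμ, hμ⟩ : ∃ (n : ℕ) (μ : Fin k → M), 1 ≤ n ∧
      (∀ i, c i = frac (x i) (μ i) n) ∧ ∀ i j, x j ^ n • μ i = x i ^ n • μ j := by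
    -- The exponent is raised by one because pro-vanishing is only assumed for `n ≥ 1`.
    refine ⟨1 + n₀, fun i => x i ^ 1 • m₀ i, Nat.le_add_right _ _, fun i => ?_, fun i j => ?_⟩
    · rw [hc₀, ← frac_eq_frac_pow_smul]
    · rw [pow_add, mul_smul, smul_comm (x j ^ n₀), hm₀, smul_smul, smul_smul, smul_smul]
      congr 1
      ring
  obtain ⟨m, hnm, h⟩ := hx n hn
  rw [koszulH1Map_eq_zero_iff] at h
  let e : (Fin k → R) →ₗ[R] M := Fintype.linearCombination R μ
  have he : ∀ i a, e (Pi.single i a) = a • μ i := fun i a => by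
    simp [e, Fintype.linearCombination_apply_single]
  -- Cycles of `x^(m)` become boundaries for `x^(n)`, which `e` kills by the cocycle relation.
  have hker : LinearMap.ker (koszulD1 (powSeq x m) R) ≤
      LinearMap.ker (e ∘ₗ koszulMap1 R x n m) := fun a ha => by
    obtain ⟨b, hb⟩ := h a ha
    rw [LinearMap.mem_ker, LinearMap.comp_apply, ← hb, koszulD2_apply, map_sum]
    refine Finset.sum_eq_zero fun p _ => ?_
    rw [map_sub, map_smul, map_smul, he, he, smul_comm, hμ, smul_comm, sub_self]
  obtain ⟨φ, hφ⟩ := exists_linearMap_of_ker_koszulD1_le _ hker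
  obtain ⟨L, hL⟩ := exists_genIdeal_pow_le (x := x) (I := genIdeal (powSeq x m))
    fun i => ⟨m, mem_genIdeal (powSeq x m) i⟩
  -- `J^L` already suffices; the extra `m` makes `x_i^(L+m)` the image of `x_i^L e_i`, so that `φ`
  -- can be evaluated there.
  have hL' : genIdeal x ^ (L + m) ≤ genIdeal (powSeq x m) :=
    (Ideal.pow_le_pow_right (Nat.le_add_right L m)).trans hL
  refine ⟨idealTransformOf _ M (L + m) (φ ∘ₗ Submodule.inclusion hL'),
    Subtype.ext (funext fun i => ?_)⟩
  have hi : koszulD1 (powSeq x m) R (Pi.single i (x i ^ L)) = x i ^ (L + m) := by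
    rw [koszulD1_single, smul_eq_mul, powSeq, ← pow_add, add_comm]
  have hφi := hφ (Pi.single i (x i ^ L))
    (hi ▸ hL' (Ideal.pow_mem_pow (mem_genIdeal x i) _))
  simp only [hi, LinearMap.comp_apply, koszulMap1_single, map_smul, he] at hφi
  rw [rho_of_apply]
  change frac (x i) (φ ⟨x i ^ (L + m), _⟩) (L + m) = c i
  rw [hφi, hcμ, ← mul_smul, ← pow_add, frac_eq_frac_pow_smul (x i) (μ i) n (m - n + L),
    show m - n + L + n = L + m by omega]

/-- The universal module with elements `m_i` satisfying `x_j^n m_i = x_i^n m_j` detects the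
vanishing of the maps of Koszul homology. -/
theorem proZero_of_rho_surjective
    (h : ∀ (M : Type (max u v)) [AddCommGroup M] [Module R M], Function.Surjective (rho x M)) :
    KoszulH1ProZero x := by
  intro n _
  let B := LinearMap.range (koszulD2 (powSeq x n) R)
  -- `ULift` only moves the cokernel into the universe over which `M` ranges.
  let q : (Fin k → R) →ₗ[R] ULift.{v} ((Fin k → R) ⧸ B) :=
    ULift.moduleEquiv.symm.toLinearMap ∘ₗ B.mkQ
  have hq : ∀ c, q c = 0 ↔ c ∈ B := fun c => by
    rw [LinearMap.comp_apply, LinearEquiv.coe_coe, LinearEquiv.map_eq_zero_iff,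
      Submodule.mkQ_apply, Submodule.Quotient.mk_eq_zero]
  have hrel : ∀ i j, i < j → x i ^ n • q (Pi.single j 1) = x j ^ n • q (Pi.single i 1) := by
    intro i j hij
    rw [← sub_eq_zero, ← map_smul, ← map_smul, ← map_sub, hq]
    refine ⟨Pi.single ⟨(i, j), hij⟩ 1, ?_⟩
    rw [koszulD2_apply, Finset.sum_eq_single ⟨(i, j), hij⟩]
    · simp
    · intro p _ hp
      simp [Pi.single_eq_of_ne hp]
    · exact fun hp => absurd (Finset.mem_univ _) hp
  have hmem := frac_mem_cechGlobalH0 (x := x) (n := n) (m := fun i => q (Pi.single i 1))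
    fun i j => by
      rcases lt_trichotomy i j with hij | rfl | hij
      · exact (hrel i j hij).symm
      · rfl
      · exact hrel j i hij
  obtain ⟨ψ, hψ⟩ := h (ULift.{v} ((Fin k → R) ⧸ B)) ⟨_, hmem⟩
  obtain ⟨L, φ, rfl⟩ := Module.DirectLimit.exists_of ψ
  have hN : ∀ i, ∃ N : ℕ,
      x i ^ N • x i ^ n • φ ⟨x i ^ L, Ideal.pow_mem_pow (mem_genIdeal x i) L⟩ =
        x i ^ N • x i ^ L • q (Pi.single i 1) := fun i => by
    have := congr_fun (congr_arg Subtype.val hψ) i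
    rw [rho_of_apply] at this
    exact frac_eq_iff.1 this
  choose N₀ hN₀ using hN
  obtain ⟨N, hN⟩ : ∃ N, ∀ i, N₀ i ≤ N :=
    ⟨Finset.univ.sup N₀, fun i => Finset.le_sup (Finset.mem_univ i)⟩
  -- In `m = N + L + n`, `L` is the power of `J` on which `φ` is defined, and `N` and `n` come from
  -- clearing denominators uniformly in `i`.
  have hnm : n ≤ N + L + n := Nat.le_add_left _ _
  have hpow : ∀ i, x i ^ (N + L + n) ∈ genIdeal x ^ L := fun i =>
    Ideal.pow_le_pow_right (by omega) (Ideal.pow_mem_pow (mem_genIdeal x i) (N + L + n))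
  have hφ : ∀ i, φ ⟨x i ^ (N + L + n), hpow i⟩ =
      x i ^ (N + L + n - n) • q (Pi.single i 1) := fun i => by
    have h1 := congr_arg (fun z => x i ^ (N - N₀ i) • z) (hN₀ i)
    simp only [smul_smul, ← pow_add, ← map_smul φ] at h1
    rw [Nat.add_sub_cancel]
    convert h1 using 2
    · refine Subtype.ext ?_
      simp only [SetLike.val_smul, smul_eq_mul, ← pow_add]
      congr 1
      have := hN i
      omega
    · congr 1
      have := hN i
      omega
  refine ⟨N + L + n, hnm, (koszulH1Map_eq_zero_iff x hnm).2 fun c hc => (hq _).1 ?_⟩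
  -- `φ` takes `x_i^m` to `x_i^(m-n) q(e_i)`, so the class of the image of `c` is `φ (∑ c_i x_i^m)`,
  -- which vanishes for a cycle.
  have hqc : q (koszulMap1 R x n (N + L + n) c) =
      φ (∑ i, c i • ⟨x i ^ (N + L + n), hpow i⟩) := by
    conv_lhs => rw [← Finset.univ_sum_single c]
    rw [map_sum, map_sum, map_sum]
    refine Finset.sum_congr rfl fun i _ => ?_
    rw [koszulMap1_single, map_smul, map_smul, hφ, smul_comm, ← map_smul q (c i), ← Pi.single_smul,
      smul_eq_mul, mul_one]
  rw [hqc, show ∑ i, c i • (⟨x i ^ (N + L + n), hpow i⟩ : ↥(genIdeal x ^ L)) = 0 from ?_, map_zero]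
  refine Subtype.ext ?_
  simp only [koszulD1, LinearMap.sum_apply, LinearMap.smul_apply, LinearMap.proj_apply,
    smul_eq_mul] at hc
  simpa [AddSubmonoidClass.coe_finsetSum, mul_comm] using hc

theorem forall_rho_bijective_iff_proZero :
    (∀ (M : Type (max u v)) [AddCommGroup M] [Module R M], Function.Bijective (rho x M)) ↔
      KoszulH1ProZero x :=
  ⟨fun h => proZero_of_rho_surjective.{u, v} x fun M _ _ => (h M).2,
    fun h M _ _ => ⟨rho_injective x M, rho_surjective_of_proZero x h M⟩⟩

end ProZero

end Deligne

theorem theorem1p1 {R : Type u} [CommRing R] {k : ℕ} (x : Fin k → R) :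
    (∀ (M : Type w) [AddCommGroup M] [Module R M],
      Deligne.rho x M = Deligne.sigma x M ∘ₗ Deligne.theta (Deligne.genIdeal x) M ∧
      Function.Injective (Deligne.theta (Deligne.genIdeal x) M) ∧
      Function.Injective (Deligne.rho x M) ∧
      Function.Bijective (Deligne.sigma x M) ∧
      (Function.Bijective (Deligne.theta (Deligne.genIdeal x) M) ↔
        Subsingleton (Deligne.CechH1 x (Deligne.IdealTransform (Deligne.genIdeal x) M))) ∧
      (Function.Bijective (Deligne.rho x M) ↔
        Subsingleton (Deligne.CechH1 x (Deligne.IdealTransform (Deligne.genIdeal x) M)))) ∧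
    ((∀ (M : Type (max u v)) [AddCommGroup M] [Module R M],
        Function.Bijective (Deligne.theta (Deligne.genIdeal x) M)) ↔
      Deligne.KoszulH1ProZero x) ∧
    ((∀ (M : Type (max u v)) [AddCommGroup M] [Module R M],
        Function.Bijective (Deligne.rho x M)) ↔
      Deligne.KoszulH1ProZero x) := by
  refine ⟨fun M _ _ => ⟨Deligne.rho_eq_sigma_comp_theta x M, Deligne.theta_injective x M,
    Deligne.rho_injective x M, Deligne.sigma_bijective x M,
    (Deligne.theta_bijective_iff_rho_bijective x M).trans
      (Deligne.rho_bijective_iff_subsingleton_cechH1 x M),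
    Deligne.rho_bijective_iff_subsingleton_cechH1 x M⟩, ?_,
    Deligne.forall_rho_bijective_iff_proZero.{u, v} x⟩
  simp only [Deligne.theta_bijective_iff_rho_bijective]
  exact Deligne.forall_rho_bijective_iff_proZero.{u, v} x
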